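/- Let $\mathbb{D}=\{z\in\mathbb{C}:|z|<1\}$. For an integer $n\ge 1$ let $\widehat\Omega_n$ be the set of all analytic functions $f(z)=z+\sum_{k=n+1}^{\infty}a_kz^k$ on $\mathbb{D}$ with $$\sum_{k=n+1}^{\infty}k(k-1)|a_k|\le\frac{n+1}{2}.$$ A convex function $\nu(z)=z+\sum_{k=2}^\infty c_kz^k$ in $\mathbb{D}$ is an analytic univalent function on $\mathbb{D}$ of this form whose image $\nu(\mathbb{D})$ is convex. For analytic functions $f(z)=z+\sum_{k\ge2}a_kz^k$ and $g(z)=z+\sum_{k\ge2}b_kz^k$ on $\mathbb{D}$, let $(f*g)(z)=z+\sum_{k\ge2}a_kb_kz^k$ be their Hadamard product. For analytic $F,G$ on $\mathbb{D}$ write $F\prec G$ if there is an analytic $w$ on $\mathbb{D}$ with $w(0)=0$, $|w(z)|<1$ and $F(z)=G(w(z))$ for all $z\in\mathbb{D}$. **Theorem.** Let $n\ge1$ be an integer and put $\tau=\dfrac{n}{2n+1}$. Then for every $f\in\widehat\Omega_n$: 1. $\tau\,(f*\nu)\prec\nu$ for every convex function $\nu(z)=z+\sum_{k=2}^\infty c_kz^k$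 in $\mathbb{D}$; 2. $\operatorname{Re} f(z)>-\dfrac{1}{2\tau}$ for every $z\in\mathbb{D}$. The number $\tau$ is best possible in both assertions: for every real $t>\tau$ there are $f\in\widehat\Omega_n$ and a convex function $\nu(z)=z+\sum_{k=2}^\infty c_kz^k$ in $\mathbb{D}$ such that $t\,(f*\nu)\not\prec\nu$, and there are $f\in\widehat\Omega_n$ and $z\in\mathbb{D}$ with $\operatorname{Re} f(z)\le-\dfrac{1}{2t}$. -/

import Mathlib

/-- The open unit disc of the complex plane. -/
abbrev unitDisc : Set ℂ := Metric.ball (0 : ℂ) 1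

/-- The `k`-th Taylor coefficient at `0`. -/
noncomputable def taylorCoeff (f : ℂ → ℂ) (k : ℕ) : ℂ :=
  iteratedDeriv k f 0 / (k.factorial : ℂ)

/-- A function analytic in the unit disc is the sum of its Taylor series there. -/
theorem hasSum_taylorCoeff {f : ℂ → ℂ} (hf : DifferentiableOn ℂ f unitDisc) {z : ℂ}
    (hz : z ∈ unitDisc) : HasSum (fun k : ℕ => taylorCoeff f k * z ^ k) (f z) := by
  have h := Complex.hasSum_taylorSeries_on_ball hf hz
  have e : (fun k : ℕ => taylorCoeff f k * z ^ k) =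
      fun k : ℕ => ((k.factorial : ℂ)⁻¹) • (z - 0) ^ k • iteratedDeriv k f 0 := by
    funext k
    simp only [taylorCoeff, smul_eq_mul, sub_zero]
    ring
  rw [e]
  exact h

/-- The class `𝒜ₙ`: functions analytic in the unit disc of the form
`f(z) = z + ∑_{k ≥ n+1} aₖ zᵏ`. -/
def classA (n : ℕ) : Set (ℂ → ℂ) :=
  {f | DifferentiableOn ℂ f unitDisc ∧ taylorCoeff f 0 = 0 ∧ taylorCoeff f 1 = 1 ∧
    ∀ k : ℕ, 2 ≤ k → k ≤ n → taylorCoeff f k = 0}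

/-- The class `Ω̂ₙ`: those `f ∈ 𝒜ₙ` for which the series `∑_{k ≥ n+1} k (k - 1) |aₖ|`
converges with sum at most `(n + 1) / 2`; the series is indexed by `k = n + 1 + j`, `j ≥ 0`. -/
def classOmegaHat (n : ℕ) : Set (ℂ → ℂ) :=
  {f | f ∈ classA n ∧
    Summable (fun j : ℕ => ((n : ℝ) + 1 + j) * ((n : ℝ) + j) * ‖taylorCoeff f (n + 1 + j)‖) ∧
    ∑' j : ℕ, ((n : ℝ) + 1 + j) * ((n : ℝ) + j) * ‖taylorCoeff f (n + 1 + j)‖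
      ≤ ((n : ℝ) + 1) / 2}

/-- Normalized convex functions in the unit disc: `ν(z) = z + ∑_{k ≥ 2} cₖ zᵏ` analytic and
univalent in the disc, with convex image. -/
def classConvex : Set (ℂ → ℂ) :=
  {ν | ν ∈ classA 1 ∧ Set.InjOn ν unitDisc ∧ Convex ℝ (ν '' unitDisc)}

/-- The Hadamard product (convolution) `(f * g)(z) = ∑ aₖ bₖ zᵏ`. -/
noncomputable def hadamard (f g : ℂ → ℂ) (z : ℂ) : ℂ :=
  ∑' k : ℕ, taylorCoeff f k * taylorCoeff g k * z ^ k

/-- The series defining the Hadamard product of two analytic functions converges in the disc. -/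
theorem summable_hadamard {f g : ℂ → ℂ} (hf : DifferentiableOn ℂ f unitDisc)
    (hg : DifferentiableOn ℂ g unitDisc) {z : ℂ} (hz : z ∈ unitDisc) :
    Summable (fun k : ℕ => taylorCoeff f k * taylorCoeff g k * z ^ k) := by
  have hz1 : ‖z‖ < 1 := by simpa using hz
  have hs1 : √‖z‖ < 1 := by
    rw [Real.sqrt_lt' one_pos]
    simpa using hz1
  have hs : ((√‖z‖ : ℝ) : ℂ) ∈ unitDisc := by
    simpa [abs_of_nonneg (Real.sqrt_nonneg _)] using hs1
  have h1 := (hasSum_taylorCoeff hf hs).summable.norm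
  have h2 := (hasSum_taylorCoeff hg hs).summable.tendsto_atTop_zero.norm
  simp only [norm_zero] at h2
  refine Summable.of_norm_bounded_eventually_nat h1 ?_
  filter_upwards [h2.eventually_le_const one_pos] with k hk
  have e : ‖taylorCoeff f k * taylorCoeff g k * z ^ k‖ =
      ‖taylorCoeff f k * ((√‖z‖ : ℝ) : ℂ) ^ k‖ * ‖taylorCoeff g k * ((√‖z‖ : ℝ) : ℂ) ^ k‖ := by
    have : ‖z‖ ^ k = √‖z‖ ^ k * √‖z‖ ^ k := by
      rw [← mul_pow, Real.mul_self_sqrt (norm_nonneg z)]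
    simp only [norm_mul, norm_pow, Complex.norm_real, Real.norm_eq_abs,
      abs_of_nonneg (Real.sqrt_nonneg _)]
    rw [this]
    ring
  rw [e]
  exact mul_le_of_le_one_right (norm_nonneg _) hk

/-- Subordination `f ≺ g` in the unit disc: `f = g ∘ w` with a Schwarz function `w`. -/
def Subordinate (f g : ℂ → ℂ) : Prop :=
  ∃ w : ℂ → ℂ, DifferentiableOn ℂ w unitDisc ∧ w 0 = 0 ∧
    (∀ z ∈ unitDisc, ‖w z‖ < 1) ∧ ∀ z ∈ unitDisc, f z = g (w z)

/-! For `k ≥ n + 1` one has `k (k - 1) ≥ n (n + 1)`, so the hypothesis gives `∑ |aₖ| ≤ 1 + 1 / (2n)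
= 1 / (2τ)`, the coefficient 1 of `z` included. Assertion 2 follows from `|f| < 1 / (2τ)`.

For assertion 1, put `bₖ = τ aₖ`, so that `∑ |bₖ| ≤ 1/2`. Then `1 + 2 Re ∑ bⱼ uʲ` is a probability
density on the circle, and `τ (f * ν)(z)` is the mean of `ν(ū z)` against it
(`mem_convex_of_hasSum_mul`). A mean stays in the closed convex hull of the compact set `ν({|ζ| ≤
|z|})`, hence in the open convex set `ν(𝔻)`; univalence of `ν` then supplies the Schwarz function.

Sharpness: `extremal n` takes real values tending to `-1 / (2τ)` as `z → -1` along the radius, and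
`z / (1 - z)`, the identity for convolution, maps the disc onto `Re w > -1/2`. -/

open Set Filter Topology

/-! ### Univalent functions and convex sets -/

/-- A function injective on a neighbourhood is not constant there. -/
theorem not_eqOn_const_of_injOn {W : Set ℂ} {f : ℂ → ℂ} (hinj : InjOn f W) {z₀ : ℂ}
    (hW : W ∈ 𝓝 z₀) : ¬ ∃ c, ∀ z ∈ W, f z = c := by
  rintro ⟨c, hc⟩
  have h : ∀ᶠ z in 𝓝[≠] z₀, z ∈ W := mem_nhdsWithin_of_mem_nhds hW
  obtain ⟨z, hz, hne⟩ := (h.and self_mem_nhdsWithin).exists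
  exact hne (hinj hz (mem_of_mem_nhds hW) ((hc z hz).trans (hc z₀ (mem_of_mem_nhds hW)).symm))

/-- An injective holomorphic function is open. -/
theorem isOpen_image_of_injOn {U s : Set ℂ} (hU : IsOpen U) (hUc : IsPreconnected U)
    {f : ℂ → ℂ} (hf : DifferentiableOn ℂ f U) (hinj : InjOn f U) (hs : s ⊆ U) (hso : IsOpen s) :
    IsOpen (f '' s) := by
  rcases U.eq_empty_or_nonempty with rfl | ⟨z₀, hz₀⟩
  · simp [subset_empty_iff.1 hs]
  rcases (hf.analyticOnNhd hU).is_constant_or_isOpen hUc with h | h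
  · exact absurd h (not_eqOn_const_of_injOn hinj (hU.mem_nhds hz₀))
  · exact h s hs hso

/-- The closed convex hull of a compact subset of an open convex set stays in that set. -/
theorem closure_convexHull_subset_of_isCompact {E : Type*} [NormedAddCommGroup E] [NormedSpace ℝ E]
    {L K : Set E} (hL : IsCompact L) (hK : Convex ℝ K) (hKo : IsOpen K) (hLK : L ⊆ K) :
    closure (convexHull ℝ L) ⊆ K := by
  obtain ⟨δ, hδ, h⟩ := hL.exists_thickening_subset_open hKo hLK
  refine (Metric.closure_subset_thickening hδ _).trans ?_
  -- Convex hull commutes with Minkowski sums, so the `δ`-thickening of the hull is the hull of the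
  -- `δ`-thickening.
  rw [← add_ball_zero, ← (convex_ball (0 : E) δ).convexHull_eq, ← convexHull_add, add_ball_zero]
  exact convexHull_min h hK

/-- The inverse of an injective holomorphic function is holomorphic. -/
theorem differentiableOn_invFunOn {U : Set ℂ} (hU : IsOpen U) (hUc : IsPreconnected U)
    {f : ℂ → ℂ} (hf : DifferentiableOn ℂ f U) (hinj : InjOn f U) :
    DifferentiableOn ℂ (Function.invFunOn f U) (f '' U) := by
  rintro _ ⟨z₀, hz₀, rfl⟩
  have hinv : ∀ z ∈ U, Function.invFunOn f U (f z) = z := fun z hz =>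
    hinj.leftInvOn_invFunOn hz
  have hopen : ∀ s ⊆ U, IsOpen s → IsOpen (f '' s) := fun s hs hso =>
    isOpen_image_of_injOn hU hUc hf hinj hs hso
  have hcont : ∀ z ∈ U, ContinuousAt (Function.invFunOn f U) (f z) := by
    intro z hz V hV
    rw [hinv z hz] at hV
    obtain ⟨W, hWV, hWo, hzW⟩ := mem_nhds_iff.1 (inter_mem hV (hU.mem_nhds hz))
    refine mem_map.2 (mem_of_superset ((hopen W (fun x hx => (hWV hx).2) hWo).mem_nhds ⟨z, hzW, rfl⟩) ?_)
    rintro _ ⟨x, hx, rfl⟩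
    simp only [mem_preimage]
    rw [hinv x (hWV hx).2]
    exact (hWV hx).1
  -- Isolated zeros of `deriv f` suffice: the inverse is differentiable off `f z₀` and continuous
  -- there, so the singularity is removable.
  have hderiv : ∀ᶠ z in 𝓝[≠] z₀, deriv f z ≠ 0 := by
    rcases ((hf.analyticOnNhd hU).deriv z₀ hz₀).eventually_eq_zero_or_eventually_ne_zero with h | h
    · exfalso
      obtain ⟨r, hr, hball⟩ := Metric.mem_nhds_iff.1 (inter_mem h (hU.mem_nhds hz₀))
      refine not_eqOn_const_of_injOn (hinj.mono fun x hx => (hball hx).2)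
        (Metric.ball_mem_nhds z₀ hr) ⟨f z₀, fun z hz => ?_⟩
      exact Metric.isOpen_ball.is_const_of_deriv_eq_zero
        (convex_ball z₀ r).isPreconnected (hf.mono fun x hx => (hball hx).2)
        (fun x hx => (hball hx).1) hz (Metric.mem_ball_self hr)
    · exact h
  rw [eventually_nhdsWithin_iff] at hderiv
  obtain ⟨W, hW, hWo, hzW⟩ := mem_nhds_iff.1 (inter_mem hderiv (hU.mem_nhds hz₀))
  have hs : f '' W ∈ 𝓝 (f z₀) :=
    (hopen W (fun x hx => (hW hx).2) hWo).mem_nhds ⟨z₀, hzW, rfl⟩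
  refine DifferentiableAt.differentiableWithinAt (DifferentiableOn.differentiableAt
    ((Complex.differentiableOn_compl_singleton_and_continuousAt_iff hs).1 ⟨?_, hcont z₀ hz₀⟩) hs)
  rintro _ ⟨⟨z, hz, rfl⟩, hne⟩
  have hzU := (hW hz).2
  refine DifferentiableAt.differentiableWithinAt (HasDerivAt.differentiableAt
    (HasDerivAt.of_local_left_inverse (f := f) (f' := deriv f z) (hcont z hzU) ?_ ?_ ?_))
  · rw [hinv z hzU]
    exact (hf.differentiableAt (hU.mem_nhds hzU)).hasDerivAt
  · exact (hW hz).1 (fun h => hne (by rw [mem_singleton_iff.1 h]; rfl))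
  · filter_upwards [(hopen U subset_rfl hU).mem_nhds (mem_image_of_mem f hzU)]
    rintro _ ⟨x, hx, rfl⟩
    rw [hinv x hx]

/-! ### Power series in the disc -/

/-- The coefficients of a power series converging in the disc are the Taylor coefficients. -/
theorem taylorCoeff_eq_of_hasSum {f : ℂ → ℂ} {c : ℕ → ℂ}
    (h : ∀ z ∈ unitDisc, HasSum (fun k => c k * z ^ k) (f z)) (k : ℕ) : taylorCoeff f k = c k := by
  have hp : HasFPowerSeriesAt f (FormalMultilinearSeries.ofScalars ℂ c) 0 := by
    rw [hasFPowerSeriesAt_iff]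
    filter_upwards [Metric.ball_mem_nhds (0 : ℂ) one_pos] with z hz
    simpa [mul_comm] using h z hz
  have hq := hp.eq_formalMultilinearSeries hp.analyticAt.hasFPowerSeriesAt
  have := congrArg (fun p => p.coeff k) hq
  simp only [FormalMultilinearSeries.coeff_ofScalars] at this
  rw [this, taylorCoeff]

/-- A power series converging in the disc is holomorphic there. -/
theorem differentiableOn_of_hasSum {f : ℂ → ℂ} {c : ℕ → ℂ}
    (h : ∀ z ∈ unitDisc, HasSum (fun k => c k * z ^ k) (f z)) : DifferentiableOn ℂ f unitDisc := by
  intro z hz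
  have hz1 : ‖z‖ < 1 := by simpa using hz
  obtain ⟨r, hzr, hr1⟩ := exists_between hz1
  have hr0 : 0 ≤ r := (norm_nonneg z).trans hzr.le
  have hr : ((r : ℝ) : ℂ) ∈ unitDisc := by simpa [abs_of_nonneg hr0] using hr1
  have hd : DifferentiableOn ℂ (fun z => ∑' k, c k * z ^ k) (Metric.ball 0 r) := by
    refine Complex.differentiableOn_tsum_of_summable_norm (h _ hr).summable.norm
      (fun k => by fun_prop) Metric.isOpen_ball fun k w hw => ?_
    rw [mem_ball_zero_iff] at hw
    simp only [norm_mul, norm_pow, Complex.norm_real, Real.norm_eq_abs, abs_of_nonneg hr0]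
    gcongr
  have hmem : Metric.ball (0 : ℂ) r ∈ 𝓝 z := Metric.isOpen_ball.mem_nhds (by simpa using hzr)
  refine ((hd.differentiableAt hmem).congr_of_eventuallyEq ?_).differentiableWithinAt
  filter_upwards [hmem] with w hw
  exact (h w (Metric.ball_subset_ball hr1.le hw)).tsum_eq.symm

/-! ### Positive kernels on the circle and subordinating factor sequences -/

open MeasureTheory AddCircle ComplexConjugate

theorem integral_fourier_eq_ite (m : ℤ) :
    ∫ x : AddCircle (1 : ℝ), fourier m x ∂haarAddCircle = if m = 0 then 1 else 0 := by
  split_ifs with h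
  · simp [h]
  · exact integral_eq_zero_of_add_right_eq_neg (μ := haarAddCircle)
      (fourier_add_half_inv_index h one_pos)

/-- Term-by-term integration of an absolutely convergent series of continuous functions against
bounded coefficients. -/
theorem hasSum_integral_mul {g : ℕ → C(AddCircle (1 : ℝ), ℂ)} {M : ℝ} (hg : ∀ j x, ‖g j x‖ ≤ M)
    {b : ℕ → ℂ} (hb : Summable fun j => ‖b j‖) {F : AddCircle (1 : ℝ) → ℂ}
    (hF : ∀ x, HasSum (fun j => b j * g j x) (F x)) :
    HasSum (fun j => b j * ∫ x, g j x ∂haarAddCircle) (∫ x, F x ∂haarAddCircle) := by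
  have h := hasSum_integral_of_summable_integral_norm (μ := haarAddCircle (T := (1 : ℝ)))
    (F := fun j x => b j * g j x)
    (fun j => (by fun_prop : Continuous fun x => b j * g j x).integrable_of_hasCompactSupport
      (HasCompactSupport.of_compactSpace _)) ?_
  · simpa only [integral_const_mul, (hF _).tsum_eq] using h
  · refine (hb.mul_right M).of_nonneg_of_le (fun j => integral_nonneg fun x => norm_nonneg _)
      fun j => ?_
    refine (integral_mono_of_nonneg (Eventually.of_forall fun x => norm_nonneg _)
      (integrable_const (‖b j‖ * M)) (Eventually.of_forall fun x => ?_)).trans (by simp)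
    simp only [norm_mul]
    gcongr
    exact hg j x

/-- The nonnegative kernel `1 + 2 Re ∑ bⱼ uʲ` on the circle. -/
noncomputable def positiveKernel (b : ℕ → ℂ) (x : AddCircle (1 : ℝ)) : ℝ :=
  1 + 2 * (∑' j : ℕ, b j * fourier (j : ℤ) x).re

theorem norm_fourier_apply (m : ℤ) (x : AddCircle (1 : ℝ)) : ‖fourier m x‖ = 1 :=
  Circle.norm_coe _

theorem summable_mul_fourier {b : ℕ → ℂ} (hb : Summable fun j => ‖b j‖) (m : ℕ → ℤ)
    (x : AddCircle (1 : ℝ)) : Summable fun j => b j * fourier (m j) x :=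
  Summable.of_norm (by simpa only [norm_mul, norm_fourier_apply, mul_one] using hb)

theorem continuous_tsum_mul_fourier {b : ℕ → ℂ} (hb : Summable fun j => ‖b j‖) (m : ℕ → ℤ) :
    Continuous fun x : AddCircle (1 : ℝ) => ∑' j, b j * fourier (m j) x :=
  continuous_tsum (fun j => by fun_prop) hb fun j x => by
    rw [norm_mul, norm_fourier_apply, mul_one]

theorem continuous_positiveKernel {b : ℕ → ℂ} (hb : Summable fun j => ‖b j‖) :
    Continuous (positiveKernel b) :=
  continuous_const.add (continuous_const.mul
    (Complex.continuous_re.comp (continuous_tsum_mul_fourier hb _)))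

theorem positiveKernel_nonneg {b : ℕ → ℂ} (hb : Summable fun j => ‖b j‖)
    (hb2 : ∑' j, ‖b j‖ ≤ 1 / 2) (x : AddCircle (1 : ℝ)) : 0 ≤ positiveKernel b x := by
  have h1 : ‖∑' j : ℕ, b j * fourier (j : ℤ) x‖ ≤ ∑' j, ‖b j‖ :=
    tsum_of_norm_bounded hb.hasSum fun j => by rw [norm_mul, norm_fourier_apply, mul_one]
  have h2 := (abs_le.1 ((Complex.abs_re_le_norm _).trans h1)).1
  rw [positiveKernel]
  linarith

/-- Expand `2 Re` as a series plus its conjugate and use orthogonality. The conjugate series has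
only nonpositive frequencies, so it could contribute only at `j = k = 0`, where `b 0 = 0`. -/
theorem integral_fourier_mul_positiveKernel {b : ℕ → ℂ} (hb : Summable fun j => ‖b j‖)
    (hb0 : b 0 = 0) (k : ℕ) :
    ∫ x : AddCircle (1 : ℝ), fourier (-(k : ℤ)) x * (positiveKernel b x : ℂ) ∂haarAddCircle
      = b k + if k = 0 then 1 else 0 := by
  have hb' : Summable fun j => ‖conj (b j)‖ := by simpa using hb
  have e : ∀ x : AddCircle (1 : ℝ), fourier (-(k : ℤ)) x * (positiveKernel b x : ℂ) =
      fourier (-(k : ℤ)) x + ∑' j : ℕ, b j * fourier ((j : ℤ) - k) x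
        + ∑' j : ℕ, conj (b j) * fourier (-(j : ℤ) - k) x := by
    intro x
    have h1 : ∀ j : ℕ, b j * fourier ((j : ℤ) - k) x =
        fourier (-(k : ℤ)) x * (b j * fourier (j : ℤ) x) := fun j => by
      rw [sub_eq_add_neg, fourier_add]; ring
    have h2 : ∀ j : ℕ, conj (b j) * fourier (-(j : ℤ) - k) x =
        fourier (-(k : ℤ)) x * conj (b j * fourier (j : ℤ) x) := fun j => by
      rw [sub_eq_add_neg, fourier_add, fourier_neg (n := (j : ℤ)), map_mul]; ring
    simp only [h1, h2]
    rw [tsum_mul_left, tsum_mul_left, ← Complex.conj_tsum, add_assoc, ← mul_add,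
      Complex.add_conj, positiveKernel]
    push_cast
    ring
  have hint : ∀ {F : AddCircle (1 : ℝ) → ℂ}, Continuous F → Integrable F haarAddCircle :=
    fun h => h.integrable_of_hasCompactSupport (HasCompactSupport.of_compactSpace _)
  have i0 : Integrable (fun x : AddCircle (1 : ℝ) => fourier (-(k : ℤ)) x) haarAddCircle :=
    hint (by fun_prop)
  have i1 := hint (continuous_tsum_mul_fourier hb fun j => (j : ℤ) - k)
  have i2 := hint (continuous_tsum_mul_fourier hb' fun j => -(j : ℤ) - k)
  simp only [e]
  have e1 := integral_add (i0.add i1) i2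
  simp only [Pi.add_apply] at e1
  rw [e1, integral_add i0 i1, integral_fourier_eq_ite]
  have s1 := hasSum_integral_mul (fun j x => (norm_fourier_apply ((j : ℤ) - k) x).le) hb
    (fun x => (summable_mul_fourier hb _ x).hasSum)
  have s2 := hasSum_integral_mul (fun j x => (norm_fourier_apply (-(j : ℤ) - k) x).le) hb'
    (fun x => (summable_mul_fourier hb' _ x).hasSum)
  simp only [integral_fourier_eq_ite] at s1 s2
  have t1 : HasSum (fun j : ℕ => b j * if (j : ℤ) - k = 0 then (1 : ℂ) else 0) (b k) := by
    convert hasSum_single (f := fun j : ℕ => b j * if (j : ℤ) - k = 0 then (1 : ℂ) else 0) k ?_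
    · simp
    · intro j hj
      rw [if_neg (by omega), mul_zero]
  have t2 : HasSum (fun j : ℕ => conj (b j) * if -(j : ℤ) - k = 0 then (1 : ℂ) else 0) 0 := by
    convert hasSum_zero with j
    rcases Nat.eq_zero_or_pos j with rfl | hj
    · simp [hb0]
    · rw [if_neg (by omega), mul_zero]
  rw [s1.unique t1, s2.unique t2]
  simp only [neg_eq_zero, Nat.cast_eq_zero]
  ring

/-- If `b₀ = 0` and `∑ |bⱼ| ≤ 1/2`, then `(bⱼ)` is a subordinating factor sequence: multiplying
the coefficients of `ν` by it stays inside any open convex set containing the image of `ν`. -/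
theorem mem_convex_of_hasSum_mul {ν : ℂ → ℂ} (hν : DifferentiableOn ℂ ν unitDisc) {K : Set ℂ}
    (hK : Convex ℝ K) (hKo : IsOpen K) (hνK : ν '' unitDisc ⊆ K) (hν0 : taylorCoeff ν 0 = 0) {b : ℕ → ℂ}
    (hb : Summable fun j => ‖b j‖) (hb0 : b 0 = 0) (hb2 : ∑' j, ‖b j‖ ≤ 1 / 2) {z s : ℂ}
    (hz : z ∈ unitDisc) (hs : HasSum (fun k => b k * taylorCoeff ν k * z ^ k) s) : s ∈ K := by
  have hz1 : ‖z‖ < 1 := by simpa using hz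
  have hsub : Metric.closedBall (0 : ℂ) ‖z‖ ⊆ unitDisc := Metric.closedBall_subset_ball hz1
  have hLc : IsCompact (ν '' Metric.closedBall 0 ‖z‖) :=
    (isCompact_closedBall (0 : ℂ) ‖z‖).image_of_continuousOn (hν.continuousOn.mono hsub)
  have hCK : closure (convexHull ℝ (ν '' Metric.closedBall 0 ‖z‖)) ⊆ K :=
    closure_convexHull_subset_of_isCompact hLc hK hKo ((image_mono hsub).trans hνK)
  -- The rotation is by the conjugate character, so that the `k`-th power of the argument extracts
  -- the coefficient `b k` of the kernel.
  have hmem : ∀ x : AddCircle (1 : ℝ), fourier (-1) x * z ∈ Metric.closedBall (0 : ℂ) ‖z‖ :=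
    fun x => by rw [mem_closedBall_zero_iff, norm_mul, norm_fourier_apply, one_mul]
  have hcont : Continuous fun x : AddCircle (1 : ℝ) => ν (fourier (-1) x * z) :=
    hν.continuousOn.comp_continuous (by fun_prop) fun x => hsub (hmem x)
  have hpow : ∀ (k : ℕ) (x : AddCircle (1 : ℝ)), fourier (-1) x ^ k = fourier (-(k : ℤ)) x := by
    intro k x
    induction k with
    | zero => simp
    | succ k ih => rw [pow_succ, ih, ← fourier_add]; congr 2; push_cast; ring
  let ρ : Measure (AddCircle (1 : ℝ)) :=
    haarAddCircle.withDensity fun x => ENNReal.ofReal (positiveKernel b x)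
  have hPm : Measurable fun x => ENNReal.ofReal (positiveKernel b x) :=
    (continuous_positiveKernel hb).measurable.ennreal_ofReal
  have hPint : Integrable (positiveKernel b) haarAddCircle :=
    (continuous_positiveKernel hb).integrable_of_hasCompactSupport
      (HasCompactSupport.of_compactSpace _)
  have hρ : IsProbabilityMeasure ρ := by
    constructor
    -- The total mass is the zeroth Fourier coefficient, `b 0 + 1 = 1`.
    have h0 := integral_fourier_mul_positiveKernel hb hb0 0
    simp only [Nat.cast_zero, neg_zero, fourier_zero, one_mul, hb0, zero_add, if_true,
      integral_complex_ofReal] at h0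
    rw [withDensity_apply _ MeasurableSet.univ, Measure.restrict_univ,
      ← ofReal_integral_eq_lintegral_ofReal hPint
        (Eventually.of_forall (positiveKernel_nonneg hb hb2))]
    rw [Complex.ofReal_eq_one.1 h0, ENNReal.ofReal_one]
  obtain ⟨M₀, hM₀⟩ := hLc.isBounded.exists_norm_le
  have hin := (convex_convexHull ℝ (ν '' Metric.closedBall 0 ‖z‖)).closure.integral_mem (μ := ρ)
    isClosed_closure
    (Eventually.of_forall fun x => subset_closure (subset_convexHull ℝ _ ⟨_, hmem x, rfl⟩))
    (Integrable.mono' (integrable_const M₀) hcont.aestronglyMeasurable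
      (Eventually.of_forall fun x => hM₀ _ ⟨_, hmem x, rfl⟩))
  have heq : ∫ x, ν (fourier (-1) x * z) ∂ρ = s := by
    rw [integral_withDensity_eq_integral_toReal_smul hPm
      (Eventually.of_forall fun x => ENNReal.ofReal_lt_top)]
    simp only [ENNReal.toReal_ofReal (positiveKernel_nonneg hb hb2 _), Complex.real_smul]
    obtain ⟨M, hM⟩ := (isCompact_range (continuous_positiveKernel hb)).isBounded.exists_norm_le
    have h := hasSum_integral_mul
      (g := fun k => ⟨fun x => fourier (-(k : ℤ)) x * (positiveKernel b x : ℂ),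
        (map_continuous (fourier (-(k : ℤ)))).mul
          (Complex.continuous_ofReal.comp (continuous_positiveKernel hb))⟩)
      (M := M) (b := fun k => taylorCoeff ν k * z ^ k)
      (F := fun x => (positiveKernel b x : ℂ) * ν (fourier (-1) x * z)) ?_
      (hasSum_taylorCoeff hν hz).summable.norm ?_
    · simp only [ContinuousMap.coe_mk, integral_fourier_mul_positiveKernel hb hb0] at h
      refine h.unique ?_
      convert hs using 2 with k
      -- At `k = 0` the kernel coefficient is 1 rather than `b 0`; the vanishing constant term of
      -- `ν` hides the discrepancy.
      rcases Nat.eq_zero_or_pos k with rfl | hk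
      · simp [hν0]
      · rw [if_neg hk.ne']; ring
    · intro k x
      simp only [ContinuousMap.coe_mk, norm_mul, norm_fourier_apply, one_mul, Complex.norm_real]
      exact hM _ ⟨x, rfl⟩
    · intro x
      have := (hasSum_taylorCoeff hν (hsub (hmem x))).mul_left (positiveKernel b x : ℂ)
      refine this.congr_fun fun k => ?_
      simp only [ContinuousMap.coe_mk, mul_pow, hpow]
      ring
  exact hCK (heq ▸ hin)

/-! ### Coefficient bounds and the two assertions -/

theorem summable_norm_taylorCoeff {n : ℕ} (hn : 1 ≤ n) {f : ℂ → ℂ} (hf : f ∈ classOmegaHat n) :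
    Summable (fun k => ‖taylorCoeff f k‖) ∧
      ∑' k, ‖taylorCoeff f k‖ ≤ 1 + 1 / (2 * (n : ℝ)) := by
  obtain ⟨⟨-, h0, h1, h2⟩, hs, hle⟩ := hf
  have hn' : (1 : ℝ) ≤ n := by exact_mod_cast hn
  have hb : ∀ j : ℕ, ‖taylorCoeff f (j + (n + 1))‖ ≤ (((n : ℝ) + 1) * n)⁻¹ *
      (((n : ℝ) + 1 + j) * ((n : ℝ) + j) * ‖taylorCoeff f (n + 1 + j)‖) := by
    intro j
    rw [add_comm j (n + 1), ← mul_assoc]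
    refine le_mul_of_one_le_left (norm_nonneg _) ?_
    rw [inv_mul_eq_div, one_le_div (by positivity)]
    have : (0 : ℝ) ≤ j := by positivity
    nlinarith
  have hst : Summable fun j => ‖taylorCoeff f (j + (n + 1))‖ :=
    (hs.mul_left _).of_nonneg_of_le (fun j => norm_nonneg _) hb
  have hS : Summable fun k => ‖taylorCoeff f k‖ :=
    (summable_nat_add_iff (n + 1)).1 hst
  refine ⟨hS, ?_⟩
  have hfin : ∑ k ∈ Finset.range (n + 1), ‖taylorCoeff f k‖ = 1 := by
    rw [Finset.sum_eq_single 1]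
    · simp [h1]
    · intro k hk hk1
      rcases Nat.eq_zero_or_pos k with rfl | hk0
      · simp [h0]
      · rw [h2 k (by omega) (by have := Finset.mem_range.1 hk; omega), norm_zero]
    · intro h
      exact absurd (Finset.mem_range.2 (by omega)) h
  rw [← hS.sum_add_tsum_nat_add (n + 1), hfin]
  gcongr
  calc _ ≤ ∑' j : ℕ, (((n : ℝ) + 1) * n)⁻¹ *
      (((n : ℝ) + 1 + j) * ((n : ℝ) + j) * ‖taylorCoeff f (n + 1 + j)‖) :=
        hst.tsum_le_tsum hb (hs.mul_left _)
    _ ≤ (((n : ℝ) + 1) * n)⁻¹ * (((n : ℝ) + 1) / 2) := by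
        rw [tsum_mul_left]
        gcongr
    _ = 1 / (2 * (n : ℝ)) := by field_simp

theorem norm_lt_of_mem_classOmegaHat {n : ℕ} (hn : 1 ≤ n) {f : ℂ → ℂ} (hf : f ∈ classOmegaHat n)
    {z : ℂ} (hz : z ∈ unitDisc) : ‖f z‖ < 1 + 1 / (2 * (n : ℝ)) := by
  obtain ⟨hS, hle⟩ := summable_norm_taylorCoeff hn hf
  have hz1 : ‖z‖ < 1 := by simpa using hz
  obtain ⟨⟨hd, h0, h1, -⟩, -⟩ := hf
  have hsum := hasSum_taylorCoeff hd hz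
  have hb : ∀ k, ‖taylorCoeff f k * z ^ k‖ ≤ ‖taylorCoeff f k‖ := fun k => by
    rw [norm_mul, norm_pow]
    exact mul_le_of_le_one_right (norm_nonneg _) (pow_le_one₀ (norm_nonneg z) hz1.le)
  rw [← hsum.tsum_eq]
  calc _ ≤ ∑' k, ‖taylorCoeff f k * z ^ k‖ := norm_tsum_le_tsum_norm hsum.summable.norm
    _ < ∑' k, ‖taylorCoeff f k‖ :=
      -- Strictness comes from the term `z` itself, since `|z| < 1`.
      Summable.tsum_lt_tsum (i := 1) hb (by simpa [h1] using hz1) hsum.summable.norm hS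
    _ ≤ _ := hle

/-- The Schwarz function is `ν⁻¹ ∘ g`, holomorphic because `ν` is univalent. -/
theorem subordinate_of_mem_image {g ν : ℂ → ℂ} (hg : DifferentiableOn ℂ g unitDisc)
    (hg0 : g 0 = 0) (hν : DifferentiableOn ℂ ν unitDisc) (hν0 : ν 0 = 0)
    (hinj : InjOn ν unitDisc) (h : ∀ z ∈ unitDisc, g z ∈ ν '' unitDisc) : Subordinate g ν := by
  refine ⟨fun z => Function.invFunOn ν unitDisc (g z), ?_, ?_, fun z hz => ?_, fun z hz => ?_⟩
  · exact (differentiableOn_invFunOn Metric.isOpen_ball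
      (convex_ball (0 : ℂ) 1).isPreconnected hν hinj).comp hg h
  · have := hinj.leftInvOn_invFunOn (Metric.mem_ball_self one_pos : (0 : ℂ) ∈ unitDisc)
    rw [hν0] at this
    simpa [hg0] using this
  · simpa using Function.invFunOn_mem (h z hz)
  · exact (Function.invFunOn_eq (h z hz)).symm

theorem taylorCoeff_zero (f : ℂ → ℂ) : taylorCoeff f 0 = f 0 := by
  simp [taylorCoeff]

/-- The convolution of `f` with a convex function, scaled by `n / (2n + 1)`, is subordinate to
the convex function. -/
theorem subordinate_hadamard {n : ℕ} (hn : 1 ≤ n) {f ν : ℂ → ℂ} (hf : f ∈ classOmegaHat n)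
    (hν : ν ∈ classConvex) :
    Subordinate (fun z => (((n : ℝ) / (2 * (n : ℝ) + 1) : ℝ) : ℂ) * hadamard f ν z) ν := by
  obtain ⟨hS, hle⟩ := summable_norm_taylorCoeff hn hf
  obtain ⟨⟨hd, h0, -, -⟩, -⟩ := hf
  obtain ⟨⟨hνd, hν0, -, -⟩, hinj, hconv⟩ := hν
  have hn' : (1 : ℝ) ≤ n := by exact_mod_cast hn
  set τ : ℝ := (n : ℝ) / (2 * (n : ℝ) + 1) with hτ
  have hτ0 : 0 ≤ τ := by positivity
  have hsum : ∀ z ∈ unitDisc, HasSum (fun k => (τ * taylorCoeff f k) * taylorCoeff ν k * z ^ k)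
      ((τ : ℂ) * hadamard f ν z) := fun z hz => by
    simpa only [hadamard, mul_assoc] using (summable_hadamard hd hνd hz).hasSum.mul_left (τ : ℂ)
  have hnorm : ∀ k, ‖(τ : ℂ) * taylorCoeff f k‖ = τ * ‖taylorCoeff f k‖ := fun k => by
    rw [norm_mul, Complex.norm_real, Real.norm_of_nonneg hτ0]
  have hz0 : (0 : ℂ) ∈ unitDisc := Metric.mem_ball_self one_pos
  refine subordinate_of_mem_image (differentiableOn_of_hasSum hsum) ?_ hνd
    (by rw [← taylorCoeff_zero ν, hν0]) hinj fun z hz => ?_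
  · refine (hsum 0 hz0).unique ?_
    convert hasSum_zero with k
    rcases Nat.eq_zero_or_pos k with rfl | hk
    · simp [h0]
    · simp [hk.ne']
  · refine mem_convex_of_hasSum_mul hνd hconv (isOpen_image_of_injOn Metric.isOpen_ball
      (convex_ball (0 : ℂ) 1).isPreconnected hνd hinj subset_rfl Metric.isOpen_ball) subset_rfl hν0 ?_ ?_ ?_ hz (hsum z hz)
    · simpa only [hnorm] using hS.mul_left τ
    · simp [h0]
    · simp only [hnorm]
      rw [tsum_mul_left]
      calc τ * ∑' k, ‖taylorCoeff f k‖ ≤ τ * (1 + 1 / (2 * (n : ℝ))) := by gcongr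
        _ = 1 / 2 := by rw [hτ]; field_simp

/-! ### Sharpness -/

/-- The extremal function `z + a z^{n+1}` with `|a| = 1 / (2n)`. -/
noncomputable def extremal (n : ℕ) (z : ℂ) : ℂ := z + (-1) ^ n / (2 * (n : ℂ)) * z ^ (n + 1)

theorem taylorCoeff_extremal (n k : ℕ) : taylorCoeff (extremal n) k =
    (if k = 1 then 1 else 0) + if k = n + 1 then (-1) ^ n / (2 * (n : ℂ)) else 0 := by
  refine taylorCoeff_eq_of_hasSum (c := fun k => (if k = 1 then 1 else 0) +
    if k = n + 1 then (-1) ^ n / (2 * (n : ℂ)) else 0) (fun z _ => ?_) k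
  simp only [add_mul]
  refine HasSum.add ?_ ?_
  · convert hasSum_single (f := fun k => (if k = 1 then (1 : ℂ) else 0) * z ^ k) 1 ?_
    · simp
    · intro k hk
      simp [hk]
  · convert hasSum_single
      (f := fun k => (if k = n + 1 then (-1) ^ n / (2 * (n : ℂ)) else 0) * z ^ k) (n + 1) ?_
    · simp
    · intro k hk
      simp [hk]

theorem extremal_mem {n : ℕ} (hn : 1 ≤ n) : extremal n ∈ classOmegaHat n := by
  have hn' : (1 : ℝ) ≤ n := by exact_mod_cast hn
  have hz : ∀ j : ℕ, j ≠ 0 → ((n : ℝ) + 1 + j) * ((n : ℝ) + j) *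
      ‖taylorCoeff (extremal n) (n + 1 + j)‖ = 0 := by
    intro j hj
    rw [taylorCoeff_extremal, if_neg (by omega), if_neg (by omega)]
    simp
  refine ⟨⟨?_, ?_, ?_, ?_⟩, summable_of_ne_finset_zero (s := {0}) ?_, ?_⟩
  · unfold extremal
    fun_prop
  · rw [taylorCoeff_extremal]; simp
  · rw [taylorCoeff_extremal]; simp
  · intro k hk hkn
    rw [taylorCoeff_extremal, if_neg (by omega), if_neg (by omega), add_zero]
  · intro j hj
    exact hz j (by simpa using hj)
  · rw [tsum_eq_single 0 hz, taylorCoeff_extremal, if_neg (by omega), if_pos rfl]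
    simp only [Nat.cast_zero, add_zero, zero_add, norm_div, norm_pow, norm_neg, norm_one, one_pow,
      norm_mul, Complex.norm_natCast, Complex.norm_ofNat]
    apply le_of_eq
    field_simp

theorem exists_extremal_re_le {n : ℕ} (hn : 1 ≤ n) {t : ℝ} (ht : (n : ℝ) / (2 * (n : ℝ) + 1) < t) :
    ∃ z ∈ unitDisc, (extremal n z).re ≤ -(1 / (2 * t)) := by
  have hn' : (1 : ℝ) ≤ n := by exact_mod_cast hn
  have ht0 : 0 < t := lt_of_le_of_lt (by positivity) ht
  -- This is `1 / (2t) < 1 / (2τ)`, the bound at `r = 1`; continuity carries it to some `r < 1`.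
  have hlt : 1 / (2 * t) < (1 : ℝ) + 1 / (2 * (n : ℝ)) * 1 ^ (n + 1) := by
    rw [div_lt_iff₀ (by positivity)] at ht ⊢
    rw [one_pow]
    field_simp
    linarith
  have hc : ContinuousAt (fun r : ℝ => r + 1 / (2 * (n : ℝ)) * r ^ (n + 1)) 1 := by fun_prop
  have hev : ∀ᶠ r in 𝓝[<] (1 : ℝ), 1 / (2 * t) < r + 1 / (2 * (n : ℝ)) * r ^ (n + 1) :=
    (hc.eventually (lt_mem_nhds hlt)).filter_mono nhdsWithin_le_nhds
  obtain ⟨r, hr, hr1, hr0⟩ := (hev.and ((eventually_mem_nhdsWithin (s := Iio (1 : ℝ))).and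
    (mem_nhdsWithin_of_mem_nhds (lt_mem_nhds (one_pos : (0 : ℝ) < 1))))).exists
  refine ⟨((-r : ℝ) : ℂ), ?_, ?_⟩
  · simpa [abs_of_pos (show 0 < r from hr0)] using hr1
  · have e : extremal n ((-r : ℝ) : ℂ) = ((-(r + 1 / (2 * (n : ℝ)) * r ^ (n + 1)) : ℝ) : ℂ) := by
      have h1 : ((-1 : ℂ)) ^ n * (-1) ^ n = 1 := by rw [← mul_pow]; simp
      rw [extremal]
      push_cast
      rw [neg_pow (r : ℂ), pow_succ (-1 : ℂ)]
      linear_combination -((r : ℂ) ^ (n + 1) / (2 * (n : ℂ))) * h1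
    rw [e, Complex.ofReal_re]
    linarith

/-- The half-plane function `z / (1 - z)`. -/
noncomputable def halfPlaneMap (z : ℂ) : ℂ := z / (1 - z)

theorem one_sub_ne_zero_of_mem {z : ℂ} (hz : z ∈ unitDisc) : 1 - z ≠ 0 := by
  intro h
  rw [← sub_eq_zero.1 h] at hz
  simp at hz

theorem taylorCoeff_halfPlaneMap (k : ℕ) :
    taylorCoeff halfPlaneMap k = if k = 0 then 0 else 1 := by
  refine taylorCoeff_eq_of_hasSum (c := fun k => if k = 0 then 0 else 1) (fun z hz => ?_) k
  have hz1 : ‖z‖ < 1 := by simpa using hz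
  have h1 := (hasSum_geometric_of_norm_lt_one hz1).sub (hasSum_single (f := fun k : ℕ =>
    if k = 0 then (1 : ℂ) else 0) 0 fun k hk => by simp [hk])
  have h2 : (1 - z)⁻¹ - (if 0 = 0 then (1 : ℂ) else 0) = halfPlaneMap z := by
    have := one_sub_ne_zero_of_mem hz
    rw [halfPlaneMap, if_pos rfl]
    field_simp
    ring
  rw [h2] at h1
  refine h1.congr_fun fun k => ?_
  rcases Nat.eq_zero_or_pos k with rfl | hk
  · simp
  · simp [hk.ne']

theorem image_halfPlaneMap : halfPlaneMap '' unitDisc = {w : ℂ | -(1 / 2) < w.re} := by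
  -- The inverse map is `w / (1 + w)`, and `|w| < |1 + w|` says that `w` is nearer to `0` than to
  -- `-1`.
  have key : ∀ w : ℂ, ‖w‖ < ‖1 + w‖ ↔ -(1 / 2) < w.re := fun w => by
    rw [← sq_lt_sq₀ (norm_nonneg _) (norm_nonneg _), Complex.sq_norm, Complex.sq_norm,
      Complex.normSq_apply, Complex.normSq_apply]
    simp only [Complex.add_re, Complex.add_im, Complex.one_re, Complex.one_im]
    constructor <;> intro h <;> nlinarith
  ext w
  constructor
  · rintro ⟨z, hz, rfl⟩
    have h := one_sub_ne_zero_of_mem hz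
    have hz1 : ‖z‖ < 1 := by simpa using hz
    have e : 1 + halfPlaneMap z = 1 / (1 - z) := by rw [halfPlaneMap]; field_simp; ring
    rw [mem_ofPred_eq, ← key, e, halfPlaneMap, norm_div, norm_div, norm_one]
    gcongr
  · intro hw
    have hlt := (key w).2 hw
    have hpos : 0 < ‖1 + w‖ := (norm_nonneg w).trans_lt hlt
    have hne : 1 + w ≠ 0 := norm_pos_iff.1 hpos
    refine ⟨w / (1 + w), ?_, ?_⟩
    · simpa [div_lt_one hpos] using hlt
    · rw [halfPlaneMap]
      have : 1 - w / (1 + w) = 1 / (1 + w) := by field_simp; ring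
      rw [this]
      field_simp

theorem halfPlaneMap_mem : halfPlaneMap ∈ classConvex := by
  refine ⟨⟨?_, ?_, ?_, ?_⟩, ?_, ?_⟩
  · exact DifferentiableOn.div (by fun_prop) (by fun_prop) fun z hz => one_sub_ne_zero_of_mem hz
  · simp [taylorCoeff_halfPlaneMap]
  · simp [taylorCoeff_halfPlaneMap]
  · intro k h1 h2
    omega
  · intro z hz w hw h
    have h1 := one_sub_ne_zero_of_mem hz
    have h2 := one_sub_ne_zero_of_mem hw
    rw [halfPlaneMap, halfPlaneMap, div_eq_div_iff h1 h2] at h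
    linear_combination h
  · rw [image_halfPlaneMap]
    exact convex_halfSpace_re_gt _

theorem hadamard_halfPlaneMap {f : ℂ → ℂ} (hf : DifferentiableOn ℂ f unitDisc)
    (h0 : taylorCoeff f 0 = 0) {z : ℂ} (hz : z ∈ unitDisc) : hadamard f halfPlaneMap z = f z := by
  rw [hadamard, ← (hasSum_taylorCoeff hf hz).tsum_eq]
  refine tsum_congr fun k => ?_
  rw [taylorCoeff_halfPlaneMap]
  rcases Nat.eq_zero_or_pos k with rfl | hk
  · simp [h0]
  · simp [hk.ne']

theorem mainTheorem2 (n : ℕ) (hn : 1 ≤ n) (τ : ℝ) (hτ : τ = (n : ℝ) / (2 * (n : ℝ) + 1)) :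
    (∀ f ∈ classOmegaHat n,
      (∀ ν ∈ classConvex, Subordinate (fun z => (τ : ℂ) * hadamard f ν z) ν) ∧
      (∀ z ∈ unitDisc, -(1 / (2 * τ)) < (f z).re)) ∧
    (∀ t : ℝ, τ < t →
      (∃ f ∈ classOmegaHat n, ∃ ν ∈ classConvex,
        ¬ Subordinate (fun z => (t : ℂ) * hadamard f ν z) ν) ∧
      (∃ f ∈ classOmegaHat n, ∃ z ∈ unitDisc, (f z).re ≤ -(1 / (2 * t)))) := by
  subst hτ
  have hn' : (1 : ℝ) ≤ n := by exact_mod_cast hn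
  refine ⟨fun f hf => ⟨fun ν hν => subordinate_hadamard hn hf hν, fun z hz => ?_⟩,
    fun t ht => ?_⟩
  · have h1 := norm_lt_of_mem_classOmegaHat hn hf hz
    have h2 := (abs_le.1 (Complex.abs_re_le_norm (f z))).1
    have h3 : 1 / (2 * ((n : ℝ) / (2 * (n : ℝ) + 1))) = 1 + 1 / (2 * (n : ℝ)) := by field_simp
    rw [h3]
    linarith
  · obtain ⟨z, hz, hre⟩ := exists_extremal_re_le hn ht
    have hmem := extremal_mem hn
    refine ⟨⟨_, hmem, _, halfPlaneMap_mem, ?_⟩, _, hmem, z, hz, hre⟩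
    rintro ⟨w, -, -, hw, h⟩
    have ht0 : 0 < t := lt_of_le_of_lt (by positivity) ht
    -- Subordination would force `t Re f(z) > -1/2`, against the choice of `z`.
    have him : halfPlaneMap (w z) ∈ {w : ℂ | -(1 / 2) < w.re} := by
      rw [← image_halfPlaneMap]
      exact ⟨w z, by simpa using hw z hz, rfl⟩
    rw [← h z hz] at him
    beta_reduce at him
    rw [hadamard_halfPlaneMap hmem.1.1 hmem.1.2.1 hz, mem_ofPred_eq,
      Complex.re_ofReal_mul] at him
    have : t * (extremal n z).re ≤ t * -(1 / (2 * t)) := by gcongr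
    have e : t * -(1 / (2 * t)) = -(1 / 2) := by field_simp
    linarith
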